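/- **Ridge bandit.** Let $d\ge 1$ and let $f:[-1,1]\to[-1,1]$ be a link function. The unknown parameter is $\theta^\star\in\mathbb S^{d-1}$. In round $t=1,2,\dots$ a learner chooses an action $a_t$ in the unit ball $\mathbb B^d$ as a measurable function of the history $(a_s,r_s)_{s<t}$ and then observes $r_t=f(\langle\theta^\star,a_t\rangle)+z_t$, with $z_1,z_2,\dots$ i.i.d. $\mathcal N(0,1)$. Assume that $f(0)=0$, $f(1)=1$, $|f|\le 1$, that either $f$ is (weakly) increasing on $[-1,1]$, or $f$ is even and (weakly) increasing on $[0,1]$, and that $f$ is $L$-Lipschitz. Put $g(x)=\max\{|f(x)|,|f(-x)|\}$. **Eluder-UCB.** Let $\widehat\theta_t\in\operatorname{argmin}_{\theta\in\mathbb S^{d-1}}\sum_{s<t}(r_s-f(\langle\theta,a_s\rangle))^2$ be a (measurably selected) least squares estimate, and let $$\mathbb C_t=\Big\{\theta\in\mathbb S^{d-1}:\ \sum_{s<t}\big(f(\langle a_s,\theta\rangle)-f(\langle a_s,\widehat\theta_t\rangle)\big)^2\le \mathrm{Est}_t\Big\}.$$ Eluder-UCB plays some $a_t\in\operatorname{argmax}_{a\in\mathbb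 B^d}\max_{\theta\in\mathbb C_t}f(\langle a,\theta\rangle)$; a tie-breaking rule selects one maximizer as a measurable function of the history. For a given tie-breaking rule, let $T^\star_{\mathrm{UCB}}(\varepsilon)\in\mathbb N\cup\{\infty\}$ be the least $T\ge 1$ such that $$\mathbb E_{\theta^\star}\Big[\max_{1\le t\le T}\langle\theta^\star,a_t\rangle\Big]\ge\varepsilon\qquad\text{for every }\theta^\star\in\mathbb S^{d-1}$$ ($\infty$ if there is no such $T$). **Theorem.** There are absolute constants $c,C_0,\kappa>0$ such that the following holds for all $d\ge1$, all $L$ and $f$ as above, all deterministic sequences of confidence parameters with $\mathrm{Est}_t\ge C_0\,d\log(2Ldt)$ for all $t\ge 1$ (for instance, with equality, so that $\mathrm{Est}_t$ is of order $d$ up to logarithmic factors), and every choice of the least squares estimates. There is a tie-breaking rule for Eluder-UCB, not depending on $\theta^\star$, $\varepsilon$ or $T$, such that for all $\varepsilon>0$ and $T\in\mathbb N$: if $T^\star_{\mathrm{UCB}}(\varepsilon)\le T$ and $\varepsilon\ge\sqrt{c\log(T)/d}$, then $$T^\star_{\mathrm{UCB}}(\varepsilon)\ \ge\ \kappa\,\frac{d}{g\big(\sqrt{c\log(T)/d}\big)^2},$$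 where the right-hand side is $+\infty$ if $g(\sqrt{c\log(T)/d})=0$ (so that this case cannot occur). -/

import Mathlib

open MeasureTheory ProbabilityTheory
open scoped ENNReal NNReal

namespace RidgeBandit

/-- The parameter set `Θ = 𝕊^{d-1}`, the Euclidean unit sphere. -/
abbrev Param (d : ℕ) : Type := Metric.sphere (0 : EuclideanSpace ℝ (Fin d)) 1

/-- The action set `𝒜 = 𝔹^d`, the closed Euclidean unit ball. -/
abbrev Action (d : ℕ) : Type := Metric.closedBall (0 : EuclideanSpace ℝ (Fin d)) 1

/-- The inner product `⟨θ, a⟩` of a parameter and an action; it lies in `[-1, 1]`. -/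
noncomputable def ip {d : ℕ} (θ : Param d) (a : Action d) : ℝ :=
  inner ℝ (θ : EuclideanSpace ℝ (Fin d)) (a : EuclideanSpace ℝ (Fin d))

/-- The regularity conditions on a link function `f : [-1, 1] → [-1, 1]`: normalized scale, and
either `f` is increasing on `[-1, 1]`, or `f` is even and increasing on `[0, 1]`. Only the values of
`f` on `[-1, 1]` matter. -/
structure IsLink (f : ℝ → ℝ) : Prop where
  map_zero : f 0 = 0
  map_one : f 1 = 1
  abs_le_one : ∀ x ∈ Set.Icc (-1 : ℝ) 1, |f x| ≤ 1
  monotone : MonotoneOn f (Set.Icc (-1) 1) ∨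
    ((∀ x ∈ Set.Icc (-1 : ℝ) 1, f (-x) = f x) ∧ MonotoneOn f (Set.Icc 0 1))

/-- `g(x) = max {|f(x)|, |f(-x)|}`. -/
noncomputable def gFun (f : ℝ → ℝ) (x : ℝ) : ℝ := max |f x| |f (-x)|

/-- A history of `n` rounds: the pairs (action, reward), in order. -/
abbrev History (d n : ℕ) : Type := Fin n → Action d × ℝ

/-- A (deterministic, nonanticipating) policy: the action of the next round as a function of the
history of the `n` rounds played so far. -/
abbrev Policy (d : ℕ) : Type := ∀ n : ℕ, History d n → Action d

/-- `lse` is a (jointly measurable) least squares estimator: for every history it is a minimizer over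
the sphere of the sum of the squared residuals `r_s - f(⟨θ, a_s⟩)`. -/
structure IsLeastSquares {d : ℕ} (f : ℝ → ℝ) (lse : ∀ n : ℕ, History d n → Param d) : Prop where
  measurable : ∀ n, Measurable (lse n)
  minimizes : ∀ (n : ℕ) (h : History d n) (θ : Param d),
    ∑ s, ((h s).2 - f (ip (lse n h) (h s).1)) ^ 2 ≤ ∑ s, ((h s).2 - f (ip θ (h s).1)) ^ 2

/-- The confidence set `ℂ` after a history `h`, centred at `center` (in the algorithm, the least
squares estimate), with squared radius `est`. -/
def confSet {d n : ℕ} (f : ℝ → ℝ) (est : ℝ) (center : Param d) (h : History d n) :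
    Set (Param d) :=
  {θ | ∑ s, (f (ip θ (h s).1) - f (ip center (h s).1)) ^ 2 ≤ est}

/-- The upper confidence bound `max_{θ ∈ C} f(⟨a, θ⟩)` of an action `a`. -/
noncomputable def ucb {d : ℕ} (f : ℝ → ℝ) (C : Set (Param d)) (a : Action d) : ℝ :=
  sSup ((fun θ => f (ip θ a)) '' C)

/-- `π` is an Eluder-UCB policy, with least squares estimates `lse` and confidence parameters `Est`
(`Est n` is used in the round that follows `n` observations): its action always belongs to the
argmax over the unit ball of the upper confidence bound. Such policies are exactly the outcomes of
the (measurable) rules of breaking ties in this argmax. -/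
structure IsEluderUCB {d : ℕ} (f : ℝ → ℝ) (Est : ℕ → ℝ) (lse : ∀ n : ℕ, History d n → Param d)
    (π : Policy d) : Prop where
  measurable : ∀ n, Measurable (π n)
  argmax : ∀ (n : ℕ) (h : History d n) (a : Action d),
    ucb f (confSet f (Est n) (lse n h) h) a ≤ ucb f (confSet f (Est n) (lse n h) h) (π n h)

/-- The history of the first `n` rounds when the policy `π` interacts with the ridge bandit with
true parameter `θ` and noise sequence `z`: the reward of action `a` in a round is
`f(⟨θ, a⟩)` plus the noise of that round. -/
noncomputable def history {d : ℕ} (f : ℝ → ℝ) (θ : Param d) (π : Policy d) (z : ℕ → ℝ) :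
    ∀ n : ℕ, History d n
  | 0 => Fin.elim0
  | n + 1 =>
      Fin.snoc (α := fun _ => Action d × ℝ) (history f θ π z n)
        (π n (history f θ π z n), f (ip θ (π n (history f θ π z n))) + z n)

/-- The largest inner product `max_{t ≤ T} ⟨θ, a_t⟩` of an action played in the first `T ≥ 1`
rounds with the true parameter. -/
noncomputable def bestInner {d : ℕ} (f : ℝ → ℝ) (θ : Param d) (π : Policy d) (T : ℕ)
    (z : ℕ → ℝ) : ℝ :=
  ⨆ t : Fin T, ip θ (π t (history f θ π z t))

/-- The law of the noise: independent standard normal variables. -/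
noncomputable def noise : Measure (ℕ → ℝ) := Measure.infinitePi fun _ => gaussianReal 0 1

/-- The sample complexity of the policy `π` of achieving inner product at least `ε`: the least
number `T ≥ 1` of rounds such that, whatever the true parameter `θ`, the expectation of the best
inner product attained in the first `T` rounds is at least `ε` (`⊤` if there is none). -/
noncomputable def sampleComplexity {d : ℕ} (f : ℝ → ℝ) (π : Policy d) (ε : ℝ) : ℕ∞ :=
  ⨅ T ∈ {T : ℕ | 1 ≤ T ∧ ∀ θ : Param d, ε ≤ ∫ z, bestInner f θ π T z ∂noise}, (T : ℕ∞)

end RidgeBandit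

namespace RidgeBandit

/-! ### Nearly orthogonal sequences on the sphere -/

/-! Since `f 1 = 1` is the largest possible value, every parameter in the confidence set, played as
an action, maximizes the upper confidence bound. Ties may therefore be broken towards a sequence `v`
fixed in advance, each term nearly orthogonal to all earlier ones (`exists_nearly_orthogonal_seq`);
`designPolicy` plays `v n` while it lies in the confidence set.

Let `T₀` be the sample complexity, `x = √(100 log T / d)`, and let `v T₀` be the true parameter. On
the design, `v n` and `v T₀` predict rewards of size at most `g x`, so their squared distance is at
most `4 T₀ g(x)²`, which is below `4 d` if the theorem fails. The least squares estimate is close to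
the truth as well (`exists_leastSquares_event`); as the design is not adaptive, a net and a union
bound suffice. So, outside an event of probability `1 / d`, each `v n` with `n < T₀` is in the
confidence set and is played (`exists_event_designPolicy_eq`), with inner product at most `x / 2`.
The expected best inner product is then at most `x / 2 + 1 / d < x ≤ ε`, a contradiction
(`le_mul_gFun_sq`). -/

/-- The real number `1` or `-1` encoded by a Boolean. -/
def boolSign (b : Bool) : ℝ := if b then 1 else -1

theorem boolSign_sq (b : Bool) : boolSign b ^ 2 = 1 := by
  cases b <;> simp [boolSign]

/-- Independence of the signs factors the sum into hyperbolic cosines, and `cosh t ≤ exp (t² / 2)`.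
-/
theorem sum_exp_boolSign_le {ι : Type*} [Fintype ι] [DecidableEq ι] (w : ι → ℝ) :
    ∑ e : ι → Bool, Real.exp (∑ i, boolSign (e i) * w i) ≤
      2 ^ Fintype.card ι * Real.exp ((∑ i, w i ^ 2) / 2) := by
  have h1 : ∑ e : ι → Bool, Real.exp (∑ i, boolSign (e i) * w i)
      = ∏ i, ∑ b : Bool, Real.exp (boolSign b * w i) := by
    rw [Finset.prod_univ_sum, Fintype.piFinset_univ]
    exact Finset.sum_congr rfl fun e _ => Real.exp_sum _ _
  rw [h1, Finset.sum_div, Real.exp_sum, ← Finset.card_univ, ← Finset.prod_const,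
    ← Finset.prod_mul_distrib]
  refine Finset.prod_le_prod (fun i _ => by positivity) fun i _ => ?_
  have h2 := Real.cosh_le_exp_half_sq (w i)
  rw [Real.cosh_eq] at h2
  simp only [Fintype.sum_bool, boolSign, if_true, one_mul, neg_mul, Bool.false_eq_true, if_false]
  linarith

/-- First moment method: some sign vector does no worse than average for the sum over `s` of `exp (l
X) + exp (-l X)`, with `l = √(log (n + 1))`. -/
theorem exists_boolSign_abs_sum_le {ι : Type*} [Fintype ι] {n : ℕ} (w : Fin n → ι → ℝ)
    (hw : ∀ s, ∑ i, w s i ^ 2 = 1) :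
    ∃ e : ι → Bool, ∀ s, |∑ i, boolSign (e i) * w s i| ≤ 3 * √(Real.log (n + 1)) := by
  classical
  rcases Nat.eq_zero_or_pos n with rfl | hn
  · exact ⟨fun _ => true, fun s => s.elim0⟩
  have hn' : (1 : ℝ) ≤ n := by exact_mod_cast hn
  have hlog : 0 < Real.log (n + 1) := Real.log_pos (by linarith)
  set l := √(Real.log (n + 1)) with hl
  have hl0 : 0 < l := Real.sqrt_pos.2 hlog
  have hl2 : l ^ 2 = Real.log (n + 1) := Real.sq_sqrt hlog.le
  have key : ∀ (s : Fin n) (a : ℝ), a ^ 2 = l ^ 2 →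
      ∑ e : ι → Bool, Real.exp (a * ∑ i, boolSign (e i) * w s i) ≤
        2 ^ Fintype.card ι * Real.exp (l ^ 2 / 2) := by
    intro s a ha
    have h := sum_exp_boolSign_le fun i => a * w s i
    have h2 : ∑ i, (a * w s i) ^ 2 = l ^ 2 := by
      simp_rw [mul_pow]
      rw [← Finset.mul_sum, hw, mul_one, ha]
    rw [h2] at h
    refine le_trans (le_of_eq (Finset.sum_congr rfl fun e _ => ?_)) h
    rw [Finset.mul_sum]
    exact congrArg _ (Finset.sum_congr rfl fun i _ => by ring)
  have hsum : ∑ e : ι → Bool, ∑ s, (Real.exp (l * ∑ i, boolSign (e i) * w s i)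
        + Real.exp (-l * ∑ i, boolSign (e i) * w s i)) ≤
      ∑ _e : ι → Bool, 2 * n * Real.exp (l ^ 2 / 2) := by
    rw [Finset.sum_comm]
    calc _ ≤ ∑ _s : Fin n, 2 * (2 ^ Fintype.card ι * Real.exp (l ^ 2 / 2)) := by
          refine Finset.sum_le_sum fun s _ => ?_
          rw [Finset.sum_add_distrib]
          linarith [key s l rfl, key s (-l) (by ring)]
      _ = _ := by
          simp only [Finset.sum_const, Finset.card_univ, Fintype.card_fin, nsmul_eq_mul,
            Fintype.card_fun, Fintype.card_bool]
          push_cast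
          ring
  obtain ⟨e, -, he⟩ := Finset.exists_le_of_sum_le Finset.univ_nonempty hsum
  refine ⟨e, fun s => ?_⟩
  have hs := (Finset.single_le_sum (f := fun s => Real.exp (l * ∑ i, boolSign (e i) * w s i)
        + Real.exp (-l * ∑ i, boolSign (e i) * w s i))
      (fun s _ => by positivity) (Finset.mem_univ s)).trans he
  set X := ∑ i, boolSign (e i) * w s i
  -- As `2 n ≤ (n + 1)² = exp (2 l²)`, the exponent is at most `5 l² / 2`; hence the constant `3`.
  have hbound : 2 * n * Real.exp (l ^ 2 / 2) ≤ Real.exp (l * (3 * l)) := by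
    have h3 : (2 * n : ℝ) ≤ Real.exp (2 * l ^ 2) := by
      have : Real.exp (2 * l ^ 2) = ((n : ℝ) + 1) ^ 2 := by
        rw [hl2, two_mul, Real.exp_add, Real.exp_log (by linarith)]
        ring
      rw [this]
      nlinarith
    calc _ ≤ Real.exp (2 * l ^ 2) * Real.exp (l ^ 2 / 2) := by gcongr
      _ = Real.exp (2 * l ^ 2 + l ^ 2 / 2) := (Real.exp_add _ _).symm
      _ ≤ _ := Real.exp_le_exp.2 (by nlinarith)
  have hp : l * X ≤ l * (3 * l) :=
    Real.exp_le_exp.1 (by linarith [Real.exp_pos (-l * X)])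
  have hm : l * -X ≤ l * (3 * l) := by
    refine Real.exp_le_exp.1 ?_
    have : l * -X = -l * X := by ring
    rw [this]
    linarith [Real.exp_pos (l * X)]
  exact abs_le'.2 ⟨le_of_mul_le_mul_left hp hl0, le_of_mul_le_mul_left hm hl0⟩

/-- A parameter, regarded as an action. -/
def Param.toAction {d : ℕ} (θ : Param d) : Action d := ⟨θ, Metric.sphere_subset_closedBall θ.2⟩

/-- The witness is a sign vector divided by `√d`. -/
theorem exists_nearly_orthogonal {d : ℕ} (hd : 1 ≤ d) {n : ℕ} (w : Fin n → Param d) :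
    ∃ θ : Param d, ∀ s, |ip θ (w s).toAction| ≤ 3 * √(Real.log (n + 1) / d) := by
  have hd0 : (0 : ℝ) < d := by exact_mod_cast hd
  obtain ⟨e, he⟩ := exists_boolSign_abs_sum_le (fun s i => (w s : EuclideanSpace ℝ (Fin d)) i)
    fun s => by
      rw [← EuclideanSpace.real_norm_sq_eq, mem_sphere_zero_iff_norm.1 (w s).2, one_pow]
  have hmem : (WithLp.toLp 2 fun i => boolSign (e i) / √d : EuclideanSpace ℝ (Fin d)) ∈
      Metric.sphere (0 : EuclideanSpace ℝ (Fin d)) 1 := by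
    rw [mem_sphere_zero_iff_norm, ← sq_eq_sq₀ (norm_nonneg _) zero_le_one,
      EuclideanSpace.real_norm_sq_eq]
    simp only [div_pow, boolSign_sq, Real.sq_sqrt hd0.le, Finset.sum_const, Finset.card_univ,
      Fintype.card_fin, nsmul_eq_mul]
    field_simp
  refine ⟨⟨_, hmem⟩, fun s => ?_⟩
  have hip : ip ⟨_, hmem⟩ (w s).toAction
      = (∑ i, boolSign (e i) * (w s : EuclideanSpace ℝ (Fin d)) i) / √d := by
    simp only [ip, Param.toAction, PiLp.inner_apply, RCLike.inner_apply, conj_trivial]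
    rw [Finset.sum_div]
    exact Finset.sum_congr rfl fun i _ => by ring
  rw [hip, abs_div, abs_of_nonneg (Real.sqrt_nonneg _), Real.sqrt_div' _ hd0.le, ← mul_div_assoc]
  gcongr
  exact he s

/-- The sequence whose next term is computed by `F` from all the previous ones. -/
def courseOfValues {α : Type*} (F : ∀ n : ℕ, (Fin n → α) → α) (n : ℕ) : α :=
  F n fun i => courseOfValues F i
termination_by n
decreasing_by exact i.2

/-- The greedy construction never stops, so the design depends on no horizon, and neither does the
tie-breaking rule. -/
theorem exists_nearly_orthogonal_seq {d : ℕ} (hd : 1 ≤ d) :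
    ∃ v : ℕ → Param d, ∀ n, ∀ s < n,
      |ip (v n) (v s).toAction| ≤ 3 * √(Real.log (n + 1) / d) := by
  choose F hF using fun n => exists_nearly_orthogonal (n := n) hd
  refine ⟨courseOfValues F, fun n s hs => ?_⟩
  rw [courseOfValues]
  exact hF n (fun i => courseOfValues F i) ⟨s, hs⟩

/-! ### Least squares for a fixed design -/

instance : IsProbabilityMeasure noise := by
  unfold noise; infer_instance

/-- Chernoff's bound with parameter `1`. The quadratic term in the threshold cancels the log-moment
generating function, which makes the bound uniform in `w`. -/
theorem noise_real_sum_ge_le {n : ℕ} (w : Fin n → ℝ) (u : ℝ) :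
    noise.real {z | (∑ s, w s ^ 2) / 2 + u ≤ ∑ s, w s * z s} ≤ Real.exp (-u) := by
  have hind : iIndepFun (fun (s : Fin n) (z : ℕ → ℝ) => w s * z s) noise := by
    have h := iIndepFun_infinitePi (P := fun _ : ℕ => gaussianReal 0 1)
      (X := fun _ : ℕ => (id : ℝ → ℝ)) (fun _ => measurable_id)
    exact (h.precomp Fin.val_injective).comp (fun s x => w s * x)
      fun s => measurable_const_mul (w s)
  have hmgf : ∀ s : Fin n, mgf (fun z : ℕ → ℝ => w s * z s) noise 1 = Real.exp (w s ^ 2 / 2) := by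
    intro s
    have hmap : noise.map (fun z : ℕ → ℝ => z s) = gaussianReal 0 1 :=
      Measure.infinitePi_map_eval (fun _ => gaussianReal 0 1) (s : ℕ)
    rw [mgf_const_mul, mgf_gaussianReal hmap]
    simp
  have hint : ∀ s : Fin n, Integrable (fun z : ℕ → ℝ => Real.exp (1 * (w s * z s))) noise := by
    intro s
    by_contra h
    have := mgf_undef (X := fun z : ℕ → ℝ => w s * z s) h
    rw [hmgf] at this
    exact (Real.exp_pos _).ne' this
  have hmeas : ∀ s : Fin n, Measurable fun z : ℕ → ℝ => w s * z s := fun s => by fun_prop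
  have h := measure_ge_le_exp_mul_mgf (μ := noise) (X := ∑ s, fun z : ℕ → ℝ => w s * z s)
    ((∑ s, w s ^ 2) / 2 + u) zero_le_one
    (hind.integrable_exp_mul_sum hmeas fun s _ => hint s)
  rw [hind.mgf_sum hmeas] at h
  simp only [hmgf, ← Real.exp_sum, ← Real.exp_add, ← Finset.sum_div, Finset.sum_apply] at h
  refine h.trans (Real.exp_le_exp.2 ?_)
  linarith

theorem abs_ip_le_one {d : ℕ} (θ : Param d) (a : Action d) : |ip θ a| ≤ 1 := by
  refine (abs_real_inner_le_norm _ _).trans ?_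
  have h1 := mem_sphere_zero_iff_norm.1 θ.2
  have h2 := mem_closedBall_zero_iff.1 a.2
  rw [h1, one_mul]
  exact h2

theorem ip_mem_Icc {d : ℕ} (θ : Param d) (a : Action d) : ip θ a ∈ Set.Icc (-1 : ℝ) 1 :=
  abs_le.1 (abs_ip_le_one θ a)

theorem abs_ip_sub_ip_le {d : ℕ} (θ θ' : Param d) (a : Action d) :
    |ip θ a - ip θ' a| ≤ ‖(θ : EuclideanSpace ℝ (Fin d)) - θ'‖ := by
  unfold ip
  rw [← inner_sub_left]
  refine (abs_real_inner_le_norm _ _).trans ?_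
  exact mul_le_of_le_one_right (norm_nonneg _) (mem_closedBall_zero_iff.1 a.2)

/-- Round the coordinates down to multiples of `1 / M` and keep one point of the sphere per occupied
cell. -/
theorem exists_net {d : ℕ} [Nonempty (Param d)] {M : ℕ} (hM : 0 < M) :
    ∃ N : Finset (Param d), N.card ≤ (2 * M + 1) ^ d ∧
      ∀ θ : Param d, ∃ θ' ∈ N, ‖(θ : EuclideanSpace ℝ (Fin d)) - θ'‖ ≤ d / M := by
  classical
  have hM' : (0 : ℝ) < M := by exact_mod_cast hM
  let k : Param d → Fin d → ℤ := fun θ i => ⌊(θ : EuclideanSpace ℝ (Fin d)) i * M⌋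
  let S : Finset (Fin d → ℤ) := Fintype.piFinset fun _ => Finset.Icc (-M : ℤ) M
  refine ⟨S.image (Function.invFun k), Finset.card_image_le.trans ?_, fun θ => ?_⟩
  · simp only [S, Fintype.card_piFinset, Int.card_Icc, Finset.prod_const, Finset.card_univ,
      Fintype.card_fin]
    gcongr
    omega
  have hcoord : ∀ i, |(θ : EuclideanSpace ℝ (Fin d)) i| ≤ 1 := fun i => by
    have h := PiLp.norm_apply_le (θ : EuclideanSpace ℝ (Fin d)) i
    rwa [mem_sphere_zero_iff_norm.1 θ.2, Real.norm_eq_abs] at h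
  have hk : k θ ∈ S := by
    refine Fintype.mem_piFinset.2 fun i => Finset.mem_Icc.2 ⟨Int.le_floor.2 ?_, ?_⟩
    · push_cast
      nlinarith [(abs_le.1 (hcoord i)).1]
    · have : (⌊(θ : EuclideanSpace ℝ (Fin d)) i * M⌋ : ℝ) ≤ M :=
        (Int.floor_le _).trans (by nlinarith [(abs_le.1 (hcoord i)).2])
      exact_mod_cast this
  refine ⟨Function.invFun k (k θ), Finset.mem_image_of_mem _ hk, ?_⟩
  have heq : k (Function.invFun k (k θ)) = k θ := Function.invFun_eq ⟨θ, rfl⟩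
  set θ' := Function.invFun k (k θ)
  have hdiff : ∀ i, ((θ : EuclideanSpace ℝ (Fin d)) i - (θ' : EuclideanSpace ℝ (Fin d)) i) ^ 2
      ≤ (1 / M : ℝ) ^ 2 := fun i => by
    have h1 := Int.abs_sub_lt_one_of_floor_eq_floor (congrFun heq i).symm
    rw [← sub_mul, abs_mul, abs_of_pos hM'] at h1
    rw [sq_le_sq, abs_of_pos (by positivity : (0 : ℝ) < 1 / M), le_div_iff₀ hM']
    exact h1.le
  rw [← sq_le_sq₀ (norm_nonneg _) (by positivity), EuclideanSpace.real_norm_sq_eq]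
  calc _ ≤ ∑ _i : Fin d, (1 / M : ℝ) ^ 2 := Finset.sum_le_sum fun i _ => hdiff i
    _ = d * (1 / M : ℝ) ^ 2 := by simp
    _ ≤ (d : ℝ) ^ 2 * (1 / M : ℝ) ^ 2 := by
        gcongr
        exact_mod_cast Nat.le_self_pow two_ne_zero d
    _ = _ := by ring

/-- A deterministic bound on the error `x` of a least squares fit in terms of a nearby vector `y`. -/
theorem sum_sq_le_of_near {n : ℕ} {x y z : Fin n → ℝ} {u : ℝ}
    (hx : ∑ s, x s ^ 2 ≤ 2 * ∑ s, x s * z s)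
    (hxy : ∀ s, |x s - y s| ≤ 1 / (n + 1))
    (hz : ∀ s, |z s| ≤ 1 / 2 + u) (hu : 0 ≤ u)
    (hy : ∑ s, y s * z s ≤ (∑ s, y s ^ 2) / 4 + 2 * u) :
    ∑ s, x s ^ 2 ≤ 10 + 24 * u := by
  have hn : (0 : ℝ) < n + 1 := by positivity
  have h1 : ∑ s, x s * z s ≤ ∑ s, y s * z s + (1 / 2 + u) := by
    have : ∑ s, (x s - y s) * z s ≤ ∑ _s : Fin n, 1 / (n + 1 : ℝ) * (1 / 2 + u) := by
      refine Finset.sum_le_sum fun s _ => (le_abs_self _).trans ?_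
      rw [abs_mul]
      gcongr
      exacts [hxy s, hz s]
    simp only [sub_mul, Finset.sum_sub_distrib, Finset.sum_const, Finset.card_univ,
      Fintype.card_fin, nsmul_eq_mul] at this
    have h2 : (n : ℝ) * (1 / (n + 1) * (1 / 2 + u)) ≤ 1 / 2 + u := by
      rw [← mul_assoc, mul_one_div]
      exact mul_le_of_le_one_left (by linarith) ((div_le_one hn).2 (by linarith))
    linarith
  -- The factor `3 / 2` leaves `2 * (1 / 4) * (3 / 2) = 3 / 4` of the sum of `x s ^ 2` on the right,
  -- to be absorbed on the left.
  have h3 : ∑ s, y s ^ 2 ≤ 3 / 2 * ∑ s, x s ^ 2 + 3 := by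
    have : ∑ s, y s ^ 2 ≤ ∑ s, (3 / 2 * x s ^ 2 + 3 * (1 / (n + 1 : ℝ))) := by
      refine Finset.sum_le_sum fun s _ => ?_
      have h4 : (x s - y s) ^ 2 ≤ 1 / (n + 1 : ℝ) := by
        have h5 : 1 / (n + 1 : ℝ) ≤ 1 := (div_le_one hn).2 (by linarith [n.cast_nonneg (α := ℝ)])
        rw [← sq_abs]
        nlinarith [hxy s, abs_nonneg (x s - y s)]
      nlinarith [sq_nonneg (3 * x s - 2 * y s), sq_nonneg (x s - 2 * (x s - y s))]
    rw [Finset.sum_add_distrib, ← Finset.mul_sum, ← Finset.mul_sum] at this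
    have h2 : ∑ _s : Fin n, 1 / (n + 1 : ℝ) ≤ 1 := by
      simp only [Finset.sum_const, Finset.card_univ, Fintype.card_fin, nsmul_eq_mul]
      rw [mul_one_div]
      exact (div_le_one hn).2 (by linarith)
    linarith
  linarith

/-- Least squares estimation of a Lipschitz ridge function from noisy observations on a fixed
design: outside an event of small probability, every least squares estimate is close to the truth. -/
theorem exists_leastSquares_event {d : ℕ} (hd : 1 ≤ d) {f : ℝ → ℝ} {L : ℝ≥0} (hL : 1 ≤ L)
    (hf : LipschitzOnWith L f (Set.Icc (-1) 1)) {n : ℕ} (a : Fin n → Action d) (θ₀ : Param d)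
    {u : ℝ} (hu : 0 ≤ u) :
    ∃ A : Set (ℕ → ℝ), MeasurableSet A ∧
      noise.real A ≤ 2 * (2 * L * d * (n + 1) : ℝ) ^ (3 * d) * Real.exp (-u) ∧
      ∀ z ∉ A, ∀ θ : Param d,
        ∑ s, (f (ip θ₀ (a s)) + z s - f (ip θ (a s))) ^ 2 ≤
          ∑ s, (f (ip θ₀ (a s)) + z s - f (ip θ₀ (a s))) ^ 2 →
        ∑ s, (f (ip θ (a s)) - f (ip θ₀ (a s))) ^ 2 ≤ 10 + 24 * u := by
  have hd' : (1 : ℝ) ≤ d := by exact_mod_cast hd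
  have hL' : (1 : ℝ) ≤ L := by exact_mod_cast hL
  have hn : (1 : ℝ) ≤ n + 1 := by linarith [n.cast_nonneg (α := ℝ)]
  have hLd : (1 : ℝ) ≤ L * d := one_le_mul_of_one_le_of_one_le hL' hd'
  have hLdn : (1 : ℝ) ≤ L * d * (n + 1) := one_le_mul_of_one_le_of_one_le hLd hn
  -- With this mesh, `L` times the net radius `d / M` is at most `1 / (n + 1)`.
  obtain ⟨M, hM1, hM2⟩ : ∃ M : ℕ, (L * d * (n + 1) : ℝ) ≤ M ∧ (M : ℝ) < L * d * (n + 1) + 1 :=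
    ⟨_, Nat.le_ceil _, Nat.ceil_lt_add_one (by linarith)⟩
  set B : ℝ := 2 * L * d * (n + 1) with hB
  have hB2 : 2 ≤ B := by rw [hB]; linarith
  have hM0 : (0 : ℝ) < M := by linarith
  have : Nonempty (Param d) := ⟨θ₀⟩
  obtain ⟨N, hNcard, hN⟩ := exists_net (d := d) (M := M) (by exact_mod_cast hM0)
  let Δ : Param d → Fin n → ℝ := fun θ s => f (ip θ (a s)) - f (ip θ₀ (a s))
  let W : (Fin n → ℝ) → Set (ℕ → ℝ) := fun w =>
    {z | (∑ s, w s ^ 2) / 2 + u ≤ ∑ s, w s * z s}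
  have hWm : ∀ w, MeasurableSet (W w) := fun w =>
    measurableSet_le measurable_const (by fun_prop)
  have hWp : ∀ w, noise.real (W w) ≤ Real.exp (-u) := fun w => noise_real_sum_ge_le w u
  -- The first family controls the noise along each net direction; the unit vectors and their
  -- negatives bound each `|z s|`, for the rounding error.
  refine ⟨(⋃ θ ∈ N, W fun s => Δ θ s / 2) ∪
    ((⋃ s ∈ (Finset.univ : Finset (Fin n)), W (Pi.single s 1)) ∪
      ⋃ s ∈ (Finset.univ : Finset (Fin n)), W (Pi.single s (-1))), ?_, ?_, ?_⟩
  · exact (N.measurableSet_biUnion fun _ _ => hWm _).union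
      ((Finset.measurableSet_biUnion _ fun _ _ => hWm _).union
        (Finset.measurableSet_biUnion _ fun _ _ => hWm _))
  · have hunion : ∀ {ι : Type} (I : Finset ι) (w : ι → Fin n → ℝ),
        noise.real (⋃ i ∈ I, W (w i)) ≤ I.card * Real.exp (-u) := fun I w => by
      refine (measureReal_biUnion_finset_le _ _).trans ?_
      refine (Finset.sum_le_sum fun i _ => hWp (w i)).trans ?_
      simp
    have h1 := hunion N fun θ s => Δ θ s / 2
    have h2 := hunion (Finset.univ : Finset (Fin n)) fun s => Pi.single s 1
    have h3 := hunion (Finset.univ : Finset (Fin n)) fun s => Pi.single s (-1)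
    rw [Finset.card_univ, Fintype.card_fin] at h2 h3
    have hcard : (N.card : ℝ) ≤ B ^ (3 * d) := by
      calc (N.card : ℝ) ≤ (2 * M + 1 : ℝ) ^ d := by exact_mod_cast hNcard
        _ ≤ (B ^ 3) ^ d := by
            gcongr
            have : (2 * M + 1 : ℝ) ≤ B + 3 := by rw [hB]; linarith
            nlinarith [pow_le_pow_left₀ (by norm_num) hB2 2]
        _ = _ := (pow_mul _ _ _).symm
    have hn2 : (n + n : ℝ) ≤ B ^ (3 * d) := by
      calc (n + n : ℝ) ≤ B := by rw [hB]; nlinarith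
        _ ≤ _ := le_self_pow₀ (by linarith) (by omega)
    calc _ ≤ (N.card : ℝ) * Real.exp (-u) + (n * Real.exp (-u) + n * Real.exp (-u)) :=
          (measureReal_union_le _ _).trans
            (add_le_add h1 ((measureReal_union_le _ _).trans (add_le_add h2 h3)))
      _ = (N.card + (n + n)) * Real.exp (-u) := by ring
      _ ≤ (B ^ (3 * d) + B ^ (3 * d)) * Real.exp (-u) := by gcongr
      _ = _ := by ring
  · intro z hz θ hθ
    simp only [Set.mem_union, Set.mem_iUnion, not_or, not_exists, Finset.mem_univ, W,
      Set.mem_ofPred_eq, not_le, forall_true_left] at hz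
    obtain ⟨hz1, hz2, hz3⟩ := hz
    obtain ⟨θ', hθ'N, hθ'⟩ := hN θ
    have habs : ∀ s : Fin n, |z s| ≤ 1 / 2 + u := fun s => by
      have h2 := hz2 s
      have h3 := hz3 s
      simp only [Pi.single_apply, ite_pow, ite_mul] at h2 h3
      simp at h2 h3
      exact abs_le'.2 ⟨by linarith, by linarith⟩
    refine sum_sq_le_of_near (x := Δ θ) (y := Δ θ') (z := fun s => z s) ?_ ?_ habs hu ?_
    · rw [← sub_nonneg, ← Finset.sum_sub_distrib] at hθ
      rw [← sub_nonneg, Finset.mul_sum, ← Finset.sum_sub_distrib]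
      refine hθ.trans_eq (Finset.sum_congr rfl fun s _ => ?_)
      simp only [Δ]
      ring
    · intro s
      have h1 := hf.dist_le_mul _ (ip_mem_Icc θ (a s)) _ (ip_mem_Icc θ' (a s))
      rw [Real.dist_eq, Real.dist_eq] at h1
      have h2 : Δ θ s - Δ θ' s = f (ip θ (a s)) - f (ip θ' (a s)) := by simp only [Δ]; ring
      rw [h2]
      refine h1.trans ((mul_le_mul_of_nonneg_left ((abs_ip_sub_ip_le _ _ _).trans hθ')
        L.coe_nonneg).trans ?_)
      rw [← mul_div_assoc, div_le_div_iff₀ hM0 (by linarith)]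
      linarith
    · have h := hz1 θ' hθ'N
      have e1 : ∑ s, (Δ θ' s / 2) ^ 2 = (∑ s, Δ θ' s ^ 2) / 4 := by
        rw [Finset.sum_div]; exact Finset.sum_congr rfl fun s _ => by ring
      have e2 : ∑ s, Δ θ' s / 2 * z s = (∑ s, Δ θ' s * z s) / 2 := by
        rw [Finset.sum_div]; exact Finset.sum_congr rfl fun s _ => by ring
      rw [e1, e2] at h
      linarith

/-! ### Eluder-UCB with ties broken in favour of a fixed design -/

variable {d : ℕ} {f : ℝ → ℝ} {L : ℝ≥0} {Est : ℕ → ℝ} {lse : ∀ n : ℕ, History d n → Param d}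
  {v : ℕ → Param d}

theorem ip_toAction_self (θ : Param d) : ip θ θ.toAction = 1 := by
  simp only [ip, Param.toAction, real_inner_self_eq_norm_sq, mem_sphere_zero_iff_norm.1 θ.2,
    one_pow]

/-- In the increasing case `f y` lies between `f (-x)` and `f x`; in the even case only `|y|`
matters. -/
theorem IsLink.abs_le_gFun (hf : IsLink f) {x y : ℝ} (hx : x ≤ 1) (hy : |y| ≤ x) :
    |f y| ≤ gFun f x := by
  have hy' := abs_le.1 hy
  have hx0 := (abs_nonneg y).trans hy
  rcases hf.monotone with h | ⟨heven, h⟩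
  · have h1 := h (a := -x) (b := y) ⟨by linarith, by linarith⟩ ⟨by linarith, by linarith⟩ hy'.1
    have h2 := h (a := y) (b := x) ⟨by linarith, by linarith⟩ ⟨by linarith, hx⟩ hy'.2
    rw [gFun, max_comm]
    exact abs_le_max_abs_abs h1 h2
  · have e : f y = f |y| := by
      rcases abs_cases y with ⟨h1, -⟩ | ⟨h1, -⟩
      · rw [h1]
      · rw [h1, heven y ⟨by linarith, by linarith⟩]
    have h1 := h (a := 0) (b := |y|) ⟨le_rfl, zero_le_one⟩ ⟨abs_nonneg _, hy.trans hx⟩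
      (abs_nonneg _)
    have h2 := h (a := |y|) (b := x) ⟨abs_nonneg _, hy.trans hx⟩ ⟨hx0, hx⟩ hy
    rw [hf.map_zero] at h1
    rw [e, abs_of_nonneg h1]
    exact h2.trans ((le_abs_self _).trans (le_max_left _ _))

theorem IsLink.one_le_of_lipschitz (hf : IsLink f) (hL : LipschitzOnWith L f (Set.Icc (-1) 1)) :
    1 ≤ L := by
  have h := hL.dist_le_mul 1 ⟨by norm_num, le_rfl⟩ 0 ⟨by norm_num, by norm_num⟩
  rw [hf.map_one, hf.map_zero] at h
  simp only [dist_zero_right, norm_one, mul_one] at h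
  exact_mod_cast h

theorem ucb_le_one (hf : IsLink f) (C : Set (Param d)) (a : Action d) : ucb f C a ≤ 1 := by
  refine Real.sSup_le ?_ zero_le_one
  rintro _ ⟨θ, -, rfl⟩
  exact (abs_le.1 (hf.abs_le_one _ (ip_mem_Icc θ a))).2

theorem one_le_ucb_toAction (hf : IsLink f) {C : Set (Param d)} {θ : Param d} (hθ : θ ∈ C) :
    1 ≤ ucb f C θ.toAction := by
  refine le_csSup ⟨1, ?_⟩ ⟨θ, hθ, by simp only [ip_toAction_self, hf.map_one]⟩
  rintro _ ⟨θ', -, rfl⟩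
  exact (abs_le.1 (hf.abs_le_one _ (ip_mem_Icc θ' _))).2

open Classical in
/-- The policy that plays the next vector of the design `v` if it belongs to the confidence set,
and the least squares estimate otherwise. -/
noncomputable def designPolicy (f : ℝ → ℝ) (Est : ℕ → ℝ) (lse : ∀ n : ℕ, History d n → Param d)
    (v : ℕ → Param d) : Policy d := fun n h =>
  if v n ∈ confSet f (Est n) (lse n h) h then (v n).toAction else (lse n h).toAction

theorem measurable_link_ip (hL : LipschitzOnWith L f (Set.Icc (-1) 1)) {α : Type*}
    [MeasurableSpace α] {θ : α → Param d} {a : α → Action d} (hθ : Measurable θ)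
    (ha : Measurable a) : Measurable fun x => f (ip (θ x) (a x)) := by
  have h1 : Measurable fun x => ip (θ x) (a x) :=
    Measurable.inner (measurable_subtype_coe.comp hθ) (measurable_subtype_coe.comp ha)
  exact hL.continuousOn.domRestrict.measurable.comp
    (h1.subtype_mk (h := fun x => ip_mem_Icc (θ x) (a x)))

theorem isEluderUCB_designPolicy (hf : IsLink f) (hL : LipschitzOnWith L f (Set.Icc (-1) 1))
    (hEst : ∀ n, 0 ≤ Est n) (hlse : ∀ n, Measurable (lse n)) :
    IsEluderUCB f Est lse (designPolicy f Est lse v) where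
  measurable n := by
    have htoAction : Measurable fun θ : Param d => θ.toAction := measurable_subtype_coe.subtype_mk
    refine Measurable.ite ?_ measurable_const (htoAction.comp (hlse n))
    change MeasurableSet {h : History d n |
      ∑ s, (f (ip (v n) (h s).1) - f (ip (lse n h) (h s).1)) ^ 2 ≤ Est n}
    refine measurableSet_le (Finset.measurable_fun_sum _ fun s _ => ?_) measurable_const
    have hs : Measurable fun h : History d n => (h s).1 := (measurable_pi_apply s).fst
    exact ((measurable_link_ip hL measurable_const hs).sub
      (measurable_link_ip hL (hlse n) hs)).pow_const 2
  argmax n h a := by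
    refine (ucb_le_one hf _ a).trans ?_
    unfold designPolicy
    split_ifs with hv
    · exact one_le_ucb_toAction hf hv
    -- The estimate is at distance zero from itself, hence in its own confidence set.
    · exact one_le_ucb_toAction hf (by simp [confSet, hEst n])

/-- As long as the confidence sets contain the design, the design is played. -/
theorem history_designPolicy {θ : Param d} {z : ℕ → ℝ} {T : ℕ}
    (hmem : ∀ n < T, ∀ h : History d n,
      (h = fun s : Fin n => ((v s).toAction, f (ip θ (v s).toAction) + z s)) →
      v n ∈ confSet f (Est n) (lse n h) h) :
    ∀ n ≤ T, history f θ (designPolicy f Est lse v) z n =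
      fun s : Fin n => ((v s).toAction, f (ip θ (v s).toAction) + z s) := by
  intro n
  induction n with
  | zero => exact fun _ => funext fun s => s.elim0
  | succ n ih =>
    intro hn
    have h := ih (by omega)
    have hπ : designPolicy f Est lse v n (history f θ (designPolicy f Est lse v) z n)
        = (v n).toAction := if_pos (hmem n (by omega) _ h)
    rw [history, hπ, h]
    funext s
    refine Fin.lastCases ?_ (fun s => ?_) s
    · simp
    · simp

theorem bestInner_le_of_history {θ : Param d} {z : ℕ → ℝ} {T : ℕ} {b : ℝ} (hT : 1 ≤ T)
    {π : Policy d} (h : ∀ n < T, ip θ (π n (history f θ π z n)) ≤ b) :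
    bestInner f θ π T z ≤ b := by
  have : Nonempty (Fin T) := ⟨⟨0, hT⟩⟩
  exact ciSup_le fun t => h t t.2

/-- If the true parameter is hard to distinguish from the vectors of the design on the basis of the
design, then with high probability the policy plays the design. -/
theorem exists_event_designPolicy_eq (hd : 1 ≤ d) (hf : IsLink f)
    (hL : LipschitzOnWith L f (Set.Icc (-1) 1))
    (hEst : ∀ n : ℕ, 1400 * d * Real.log (2 * L * d * (n + 1)) ≤ Est n)
    (hlse : IsLeastSquares f lse) (θ : Param d) (T : ℕ)
    (hclose : ∀ n < T, ∑ s : Fin n,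
      (f (ip (v n) (v s).toAction) - f (ip θ (v s).toAction)) ^ 2 ≤ Est n / 4) :
    ∃ A : Set (ℕ → ℝ), MeasurableSet A ∧ noise.real A ≤ 1 / d ∧ ∀ z ∉ A, ∀ n < T,
      designPolicy f Est lse v n (history f θ (designPolicy f Est lse v) z n) =
        (v n).toAction := by
  have hL1 := hf.one_le_of_lipschitz hL
  have hd' : (1 : ℝ) ≤ d := by exact_mod_cast hd
  have hL' : (1 : ℝ) ≤ L := by exact_mod_cast hL1
  set B : ℕ → ℝ := fun n => 2 * L * d * (n + 1) with hB
  have hB' : ∀ n, 2 * d * (n + 1) ≤ B n := fun n => by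
    have : 2 * d * (n + 1) * 1 ≤ 2 * d * (n + 1 : ℝ) * L := by gcongr
    simp only [hB]
    linarith
  have hB2 : ∀ n, 2 ≤ B n := fun n => by
    have h1 : (1 : ℝ) ≤ n + 1 := by linarith [n.cast_nonneg (α := ℝ)]
    have := one_le_mul_of_one_le_of_one_le hd' h1
    linarith [hB' n]
  have hlog : ∀ n, 1 / 2 ≤ d * Real.log (B n) := fun n => by
    have h1 : Real.log 2 ≤ Real.log (B n) := Real.log_le_log two_pos (hB2 n)
    nlinarith [Real.log_two_gt_d9]
  -- The factor `exp (-u) = B ^ (-7 d)` beats the net factor `B ^ (3 d)`, while `2 (10 + 24 u)`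
  -- stays below `Est n / 2`.
  choose A hAm hAp hA using fun n : ℕ =>
    exists_leastSquares_event (n := n) hd hL1 hL (fun s => (v s).toAction) θ
      (u := 7 * (d * Real.log (B n))) (by linarith [hlog n])
  -- A telescoping bound, so that the union over all rounds costs at most `1 / d` whatever `T` is.
  have hprob : ∀ n : ℕ, noise.real (A n) ≤ 1 / d * (1 / (n + 1) - 1 / ((n + 1 : ℕ) + 1)) := by
    intro n
    have hBpos : 0 < B n := by linarith [hB2 n]
    have hexp : Real.exp (-(7 * (d * Real.log (B n)))) = (B n ^ (7 * d))⁻¹ := by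
      rw [Real.exp_neg, ← mul_assoc, mul_comm _ (Real.log (B n)), Real.exp_mul,
        Real.exp_log hBpos, ← Real.rpow_natCast]
      push_cast
      rfl
    have hn0 : (0 : ℝ) < n + 1 := by positivity
    have hd0 : (0 : ℝ) < d := by linarith
    calc noise.real (A n) ≤ 2 * B n ^ (3 * d) * Real.exp (-(7 * (d * Real.log (B n)))) := hAp n
      _ = 2 / B n ^ (4 * d) := by
          rw [hexp, show 7 * d = 3 * d + 4 * d by ring, pow_add]
          field_simp
      _ ≤ 2 / B n ^ 2 := by
          gcongr
          · linarith [hB2 n]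
          · omega
      _ ≤ 2 / (2 * d * (n + 1 : ℝ)) ^ 2 := by
          gcongr
          exact hB' n
      _ ≤ 1 / (d * ((n + 1) * (n + 2))) := by
          rw [div_le_div_iff₀ (by positivity) (by positivity)]
          have : (n + 2 : ℝ) ≤ 2 * d * (n + 1) := by nlinarith
          have h3 : d * (n + 1 : ℝ) * (n + 2) ≤ d * (n + 1 : ℝ) * (2 * d * (n + 1)) := by gcongr
          linarith
      _ = _ := by
          push_cast
          field_simp
          ring
  refine ⟨⋃ n ∈ Finset.range T, A n, Finset.measurableSet_biUnion _ fun n _ => hAm n, ?_, ?_⟩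
  · refine (measureReal_biUnion_finset_le _ _).trans
      ((Finset.sum_le_sum fun n _ => hprob n).trans ?_)
    rw [← Finset.mul_sum, Finset.sum_range_sub' fun n : ℕ => 1 / ((n : ℝ) + 1)]
    refine mul_le_of_le_one_right (by positivity) ?_
    have : 0 ≤ 1 / ((T : ℝ) + 1) := by positivity
    simp only [Nat.cast_zero, zero_add, div_one]
    linarith
  · intro z hz
    simp only [Set.mem_iUnion, not_exists, Finset.mem_range] at hz
    have hmem : ∀ n < T, ∀ h : History d n,
        (h = fun s : Fin n => ((v s).toAction, f (ip θ (v s).toAction) + z s)) →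
        v n ∈ confSet f (Est n) (lse n h) h := by
      intro n hn h hh
      have h1 := hA n z (hz n hn) (lse n h) (by
        have := hlse.minimizes n h θ
        subst hh
        exact this)
      have h2 := hclose n hn
      have h3 := hEst n
      have h4 := hlog n
      simp only [confSet, Set.mem_ofPred_eq]
      have h5 : ∀ s : Fin n, (f (ip (v n) (h s).1) - f (ip (lse n h) (h s).1)) ^ 2 ≤
          2 * (f (ip (v n) (v s).toAction) - f (ip θ (v s).toAction)) ^ 2 +
          2 * (f (ip (lse n h) (v s).toAction) - f (ip θ (v s).toAction)) ^ 2 := by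
        intro s
        have e : (h s).1 = (v s).toAction := by rw [hh]
        rw [e]
        nlinarith [sq_nonneg (f (ip (v n) (v s).toAction) - f (ip θ (v s).toAction) +
          (f (ip (lse n h) (v s).toAction) - f (ip θ (v s).toAction)))]
      refine (Finset.sum_le_sum fun s _ => h5 s).trans ?_
      rw [Finset.sum_add_distrib, ← Finset.mul_sum, ← Finset.mul_sum]
      linarith
    intro n hn
    exact if_pos (hmem n hn _ (history_designPolicy hmem n hn.le))

/-! ### From the played design to the sample complexity -/

theorem bestInner_le_one {θ : Param d} {π : Policy d} {T : ℕ} (hT : 1 ≤ T) (z : ℕ → ℝ) :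
    bestInner f θ π T z ≤ 1 :=
  bestInner_le_of_history hT fun _ _ => (abs_le.1 (abs_ip_le_one _ _)).2

theorem integral_bestInner_le {θ : Param d} {π : Policy d} {T : ℕ} (hT : 1 ≤ T) {A : Set (ℕ → ℝ)}
    (hA : MeasurableSet A) {b : ℝ} (hb : 0 ≤ b) (h : ∀ z ∉ A, bestInner f θ π T z ≤ b) :
    ∫ z, bestInner f θ π T z ∂noise ≤ b + noise.real A := by
  -- Without integrability the integral is `0` by convention and the bound still holds, so
  -- measurability of the best inner product need not be shown.
  by_cases hint : Integrable (bestInner f θ π T) noise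
  · have hind : Integrable (A.indicator fun _ => (1 : ℝ)) noise :=
      (integrable_const 1).indicator hA
    calc _ ≤ ∫ z, (b + A.indicator (fun _ => (1 : ℝ)) z) ∂noise := by
          refine integral_mono hint ((integrable_const b).add hind) fun z => ?_
          by_cases hz : z ∈ A
          · simp only [Set.indicator_of_mem hz]
            linarith [bestInner_le_one (f := f) (θ := θ) (π := π) hT z]
          · simp only [Set.indicator_of_notMem hz, add_zero]
            exact h z hz
      _ = b + noise.real A := by
          rw [integral_add (integrable_const b) hind, integral_indicator_const _ hA]
          simp
  · rw [integral_undef hint]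
    positivity

theorem exists_sampleComplexity_eq {π : Policy d} {ε : ℝ} {T : ℕ}
    (h : sampleComplexity f π ε ≤ T) :
    ∃ T₀ : ℕ, sampleComplexity f π ε = T₀ ∧ T₀ ≤ T ∧ 1 ≤ T₀ ∧
      ∀ θ : Param d, ε ≤ ∫ z, bestInner f θ π T₀ z ∂noise := by
  rw [sampleComplexity, ← sInf_image] at h ⊢
  have hne : ((fun T : ℕ => (T : ℕ∞)) ''
      {T : ℕ | 1 ≤ T ∧ ∀ θ : Param d, ε ≤ ∫ z, bestInner f θ π T z ∂noise}).Nonempty := by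
    by_contra hempty
    rw [Set.not_nonempty_iff_eq_empty.1 hempty, sInf_empty] at h
    exact absurd h (by simp)
  obtain ⟨T₀, ⟨h1, h2⟩, h3⟩ := csInf_mem hne
  refine ⟨T₀, h3.symm, ?_, h1, h2⟩
  have h4 : (T₀ : ℕ∞) ≤ T := h3.trans_le h
  exact_mod_cast h4

/-- No policy has sample complexity one: a deterministic first action cannot be positively
correlated with all the parameters. -/
theorem one_lt_of_le_integral_bestInner [Nonempty (Param d)] {π : Policy d} {ε : ℝ} (hε : 0 < ε)
    {T : ℕ} (hT : 1 ≤ T) (h : ∀ θ : Param d, ε ≤ ∫ z, bestInner f θ π T z ∂noise) : 1 < T := by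
  by_contra hT'
  obtain rfl : T = 1 := by omega
  have hbest : ∀ θ : Param d, ∫ z, bestInner f θ π 1 z ∂noise = ip θ (π 0 Fin.elim0) := fun θ => by
    have : ∀ z, bestInner f θ π 1 z = ip θ (π 0 Fin.elim0) := fun z => by
      simp only [bestInner, ciSup_unique]
      rfl
    simp [this]
  obtain ⟨θ⟩ := ‹Nonempty (Param d)›
  have h1 := h θ
  have h2 := h (-θ)
  rw [hbest] at h1 h2
  have h3 : ip (-θ) (π 0 Fin.elim0) = -ip θ (π 0 Fin.elim0) := inner_neg_left _ _
  linarith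

/-- The lower bound for the policy that follows a nearly orthogonal design. -/
theorem le_mul_gFun_sq (hd : 1 ≤ d) (hf : IsLink f) (hL : LipschitzOnWith L f (Set.Icc (-1) 1))
    (hEst : ∀ n : ℕ, 1400 * d * Real.log (2 * L * d * (n + 1)) ≤ Est n)
    (hlse : IsLeastSquares f lse)
    (hv : ∀ n, ∀ s < n, |ip (v n) (v s).toAction| ≤ 3 * √(Real.log (n + 1) / d))
    {ε : ℝ} (hε : 0 < ε) {T₀ T : ℕ} (hT₀ : 1 ≤ T₀) (hT : T₀ ≤ T)
    (hbest : ∀ θ : Param d, ε ≤ ∫ z, bestInner f θ (designPolicy f Est lse v) T₀ z ∂noise)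
    (hTε : √(100 * Real.log T / d) ≤ ε) :
    (d : ℝ) ≤ T₀ * gFun f √(100 * Real.log T / d) ^ 2 := by
  by_contra! hlt
  have hd' : (1 : ℝ) ≤ d := by exact_mod_cast hd
  have hd0 : (0 : ℝ) < d := by linarith
  have hL1 : (1 : ℝ) ≤ L := by exact_mod_cast hf.one_le_of_lipschitz hL
  have : Nonempty (Param d) := ⟨v 0⟩
  -- This keeps `log T` away from `0`; with `T = 1` one would have `x = 0`.
  have hT1 : 1 < T₀ := one_lt_of_le_integral_bestInner hε hT₀ hbest
  have hT2 : (2 : ℝ) ≤ T := by exact_mod_cast hT1.trans_le hT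
  have hlogT : Real.log 2 ≤ Real.log T := Real.log_le_log two_pos hT2
  have hlog2 := Real.log_two_gt_d9
  set x := √(100 * Real.log T / d) with hx
  have hx0 : 0 ≤ x := Real.sqrt_nonneg _
  have hε1 : ε ≤ 1 := by
    have := (hbest (v 0)).trans (integral_bestInner_le hT₀ MeasurableSet.empty zero_le_one
      fun z _ => bestInner_le_one hT₀ z)
    simpa using this
  have hx1 : x ≤ 1 := hTε.trans hε1
  -- The range includes `n = T₀`, the true parameter. Since `n + 1 ≤ T²`, the bound is `3 √(2 log T
  -- / d) ≤ x / 2`, where `2 ≤ 100 / 36`.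
  have hortho : ∀ n ≤ T₀, ∀ s < n, |ip (v n) (v s).toAction| ≤ x / 2 := by
    intro n hn s hs
    refine (hv n s hs).trans ?_
    have hlog : Real.log (n + 1) ≤ 2 * Real.log T := by
      have hnT : (n : ℝ) ≤ T := by exact_mod_cast hn.trans hT
      rw [← Real.log_rpow (by linarith)]
      refine Real.log_le_log (by positivity) ?_
      rw [Real.rpow_two]
      nlinarith
    have h1 : √(Real.log (n + 1) / d) ≤ x / 6 := by
      refine Real.sqrt_le_iff.2 ⟨by positivity, ?_⟩
      rw [div_pow, hx, Real.sq_sqrt (by positivity), div_div, mul_comm (d : ℝ), ← div_div]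
      gcongr
      linarith
    linarith
  have hclose : ∀ n < T₀, ∑ s : Fin n,
      (f (ip (v n) (v s).toAction) - f (ip (v T₀) (v s).toAction)) ^ 2 ≤ Est n / 4 := by
    intro n hn
    have hterm : ∀ s : Fin n,
        (f (ip (v n) (v s).toAction) - f (ip (v T₀) (v s).toAction)) ^ 2 ≤ 4 * gFun f x ^ 2 := by
      intro s
      have h1 := hf.abs_le_gFun hx1 ((hortho n hn.le s s.2).trans (by linarith))
      have h2 := hf.abs_le_gFun hx1 ((hortho T₀ le_rfl s (s.2.trans hn)).trans (by linarith))
      have h3 := abs_le.1 ((abs_sub _ _).trans (add_le_add h1 h2))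
      nlinarith
    have hn' : (n : ℝ) ≤ T₀ := by exact_mod_cast hn.le
    have hlogB : Real.log 2 ≤ Real.log (2 * L * d * (n + 1)) := by
      refine Real.log_le_log two_pos ?_
      have h1 : (1 : ℝ) ≤ n + 1 := by linarith [n.cast_nonneg (α := ℝ)]
      have := one_le_mul_of_one_le_of_one_le (one_le_mul_of_one_le_of_one_le hL1 hd') h1
      linarith
    calc _ ≤ ∑ _s : Fin n, 4 * gFun f x ^ 2 := Finset.sum_le_sum fun s _ => hterm s
      _ = 4 * (n * gFun f x ^ 2) := by simp; ring
      _ ≤ 4 * (T₀ * gFun f x ^ 2) := by gcongr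
      _ ≤ Est n / 4 := by nlinarith [hEst n]
  obtain ⟨A, hAm, hAp, hA⟩ := exists_event_designPolicy_eq hd hf hL hEst hlse (v T₀) T₀ hclose
  have hint := (hbest (v T₀)).trans (integral_bestInner_le hT₀ hAm (b := x / 2) (by positivity)
    fun z hz => bestInner_le_of_history hT₀ fun n hn => by
      rw [hA z hz n hn]
      exact (le_abs_self _).trans (hortho T₀ le_rfl n hn))
  -- Squared, this is `1 / d² < 25 log T / d`, true as `log T ≥ log 2` and `d ≥ 1`.
  have hxd : 1 / (d : ℝ) < x / 2 := by
    rw [lt_div_iff₀ two_pos, hx]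
    refine Real.lt_sqrt_of_sq_lt ?_
    rw [div_mul_eq_mul_div, div_pow, div_lt_div_iff₀ (by positivity) hd0]
    nlinarith
  linarith

end RidgeBandit

theorem theorem1p3 :
    ∃ c C₀ κ : ℝ, 0 < c ∧ 0 < C₀ ∧ 0 < κ ∧
      ∀ (d : ℕ), 1 ≤ d →
      ∀ (f : ℝ → ℝ), RidgeBandit.IsLink f →
      ∀ (L : ℝ≥0), LipschitzOnWith L f (Set.Icc (-1) 1) →
      ∀ (Est : ℕ → ℝ),
        (∀ n : ℕ, C₀ * d * Real.log (2 * L * d * (n + 1)) ≤ Est n) →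
      ∀ (lse : ∀ n : ℕ, RidgeBandit.History d n → RidgeBandit.Param d),
        RidgeBandit.IsLeastSquares f lse →
      ∃ π : RidgeBandit.Policy d, RidgeBandit.IsEluderUCB f Est lse π ∧
        ∀ (ε : ℝ) (T : ℕ), 0 < ε →
          RidgeBandit.sampleComplexity f π ε ≤ T →
          Real.sqrt (c * Real.log T / d) ≤ ε →
          ENNReal.ofReal κ *
              ((d : ℝ≥0∞) /
                ENNReal.ofReal (RidgeBandit.gFun f (Real.sqrt (c * Real.log T / d))) ^ 2) ≤
            (RidgeBandit.sampleComplexity f π ε : ℝ≥0∞) := by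
  refine ⟨100, 1400, 1, by norm_num, by norm_num, one_pos, ?_⟩
  intro d hd f hf L hL Est hEst lse hlse
  obtain ⟨v, hv⟩ := RidgeBandit.exists_nearly_orthogonal_seq hd
  have hEst0 : ∀ n, 0 ≤ Est n := fun n => by
    refine le_trans (mul_nonneg (by positivity) (Real.log_nonneg ?_)) (hEst n)
    have hL1 : (1 : ℝ) ≤ L := by exact_mod_cast hf.one_le_of_lipschitz hL
    have hd' : (1 : ℝ) ≤ d := by exact_mod_cast hd
    have hn : (1 : ℝ) ≤ n + 1 := by linarith [n.cast_nonneg (α := ℝ)]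
    have := one_le_mul_of_one_le_of_one_le (one_le_mul_of_one_le_of_one_le hL1 hd') hn
    linarith
  refine ⟨RidgeBandit.designPolicy f Est lse v,
    RidgeBandit.isEluderUCB_designPolicy hf hL hEst0 hlse.measurable, ?_⟩
  intro ε T hε hT hTε
  obtain ⟨T₀, hT₀, hT₀T, hT₀1, hbest⟩ := RidgeBandit.exists_sampleComplexity_eq hT
  have h := RidgeBandit.le_mul_gFun_sq hd hf hL hEst hlse hv hε hT₀1 hT₀T hbest hTε
  rw [hT₀, ENNReal.ofReal_one, one_mul]
  -- The product form also covers a vanishing `gFun`: `h` would then force `d ≤ 0`.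
  refine ENNReal.div_le_of_le_mul ?_
  have hg : 0 ≤ RidgeBandit.gFun f √(100 * Real.log T / d) :=
    (abs_nonneg _).trans (le_max_left _ _)
  rw [← ENNReal.ofReal_pow hg, ← ENNReal.ofReal_natCast d]
  refine (ENNReal.ofReal_le_ofReal h).trans_eq ?_
  rw [ENNReal.ofReal_mul (by positivity), ENNReal.ofReal_natCast]
  rfl
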